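/- All manifolds are finite-dimensional, real, smooth, Hausdorff and second countable, without boundary. A Poisson structure on a manifold $M$ is a smooth bivector field $\pi$ whose bracket $\{f,g\}=\pi(\mathrm{d}f,\mathrm{d}g)$ on $C^\infty(M)$ satisfies the Jacobi identity; a smooth map $F\colon N\to M$ of Poisson manifolds is Poisson if $F^*\colon C^\infty(M)\to C^\infty(N)$ preserves brackets; products carry the product Poisson structure. Write $\pi^\sharp(\mu)=\pi(\mu,\cdot)$, $\mathbb{T}M=TM\oplus T^*M$ and $\mathrm{Gr}(\pi)=\{\pi^\sharp(\mu)+\mu : \mu\in T^*M\}\subset\mathbb{T}M$. Let $G$ be a Lie group with Lie algebra $\mathfrak{g}$ and multiplication $\mathrm{Mult}\colon G\times G\to G$. Let $\mathbb{T}G\rightrightarrows\mathfrak{g}^*$ be the groupoid in which, for $x_i=v_i+\mu_i\in\mathbb{T}_{g_i}G$ and $x=v+\mu\in\mathbb{T}_gG$, one has $x=x_1\circ x_2$ if and only if $g=g_1g_2$, $v=\mathrm{Mult}_*(v_1,v_2)$ and $(\mu_1,\mu_2)=\mathrm{Mult}^*\mu$; its units are the elements $0+\nu\in\mathbb{T}_eG$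 with $\nu\in\mathfrak{g}^*=T_e^*G$, and source and target of $v+\mu$ are the left and the right trivialization of $\mu$. A subset of the arrows of a Lie groupoid is a Lie subgroupoid if it is an embedded submanifold and is a Lie groupoid, over an embedded submanifold of the base, for the restricted structure maps. **Theorem.** Let $\pi$ be a Poisson structure on $G$. Then $(G,\pi)$ is a Poisson Lie group (that is, $\mathrm{Mult}$ is a Poisson map) if and only if $\mathrm{Gr}(\pi)$ is a Lie subgroupoid of $\mathbb{T}G\rightrightarrows\mathfrak{g}^*$. **Proposition.** Let $(G,\pi_G)$ be a Poisson Lie group, let $(M,\pi_M)$ be a Poisson manifold, and let $\mathcal{A}\colon G\times M\to M$ be a smooth action. Let $\Phi\colon\mathbb{T}M\to\mathfrak{g}^*$ be given by $\Phi(w+\nu)(\xi)=\nu\big(\tfrac{d}{dt}|_{t=0}\exp(t\xi)\cdot m\big)$ for $w+\nu\in\mathbb{T}_mM$, and let $\mathbb{T}G\rightrightarrows\mathfrak{g}^*$ act on $\mathbb{T}M$ along $\Phi$ by $(v+\mu)\circ(w+\nu)=w'+\nu'\in\mathbb{T}_{g\cdot m}M$, for $v+\mu\in\mathbb{T}_gG$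 and $w+\nu\in\mathbb{T}_mM$ with the source of $v+\mu$ equal to $\Phi(w+\nu)$, where $w'=\mathcal{A}_*(v,w)$ and $\nu'$ is determined by $\mathcal{A}^*\nu'=(\mu,\nu)$. Then the action of $G$ on $M$ is a Poisson action (that is, $\mathcal{A}$ is a Poisson map) if and only if this groupoid action restricts to an action of the subgroupoid $\mathrm{Gr}(\pi_G)$ on $\mathrm{Gr}(\pi_M)$, that is, $x\circ y\in\mathrm{Gr}(\pi_M)$ for all $x\in\mathrm{Gr}(\pi_G)$ and $y\in\mathrm{Gr}(\pi_M)$ for which $x\circ y$ is defined. -/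

import Mathlib

open scoped Manifold ContDiff
open Bundle

noncomputable section

/-! ### Submersions and embeddings -/

section Maps

variable {E : Type*} [NormedAddCommGroup E] [NormedSpace ℝ E] {H : Type*} [TopologicalSpace H]
  (I : ModelWithCorners ℝ E H)
  {E' : Type*} [NormedAddCommGroup E'] [NormedSpace ℝ E'] {H' : Type*} [TopologicalSpace H']
  (J : ModelWithCorners ℝ E' H')
  {M : Type*} [TopologicalSpace M] [ChartedSpace H M]
  {N : Type*} [TopologicalSpace N] [ChartedSpace H' N]

/-- A smooth submersion (of finite-dimensional manifolds): smooth with surjective differentials. -/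
structure IsSmoothSubmersion (f : M → N) : Prop where
  contMDiff : ContMDiff I J ∞ f
  surjective_mfderiv : ∀ x, Function.Surjective (mfderiv I J f x)

/-- A smooth embedding (of finite-dimensional manifolds): a smooth immersion which is a
homeomorphism onto its image. -/
structure IsSmoothEmb (f : M → N) : Prop where
  contMDiff : ContMDiff I J ∞ f
  injective_mfderiv : ∀ x, Function.Injective (mfderiv I J f x)
  isEmbedding : Topology.IsEmbedding f

end Maps

/-! ### Groupoids, Lie groupoids, Lie subgroupoids, groupoid actions -/

/-- A groupoid `Γ ⇉ B`. The product `mul g h` is `g ∘ h` for composable pairs, that is, when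
`src g = tgt h`; its values on other pairs carry no meaning and no axiom mentions them. -/
structure GroupoidOver (Γ B : Type*) where
  src : Γ → B
  tgt : Γ → B
  unit : B → Γ
  mul : Γ → Γ → Γ
  src_unit : ∀ b, src (unit b) = b
  tgt_unit : ∀ b, tgt (unit b) = b
  src_mul : ∀ g h, src g = tgt h → src (mul g h) = src h
  tgt_mul : ∀ g h, src g = tgt h → tgt (mul g h) = tgt g
  assoc : ∀ g h k, src g = tgt h → src h = tgt k → mul (mul g h) k = mul g (mul h k)
  unit_mul : ∀ g, mul (unit (tgt g)) g = g
  mul_unit : ∀ g, mul g (unit (src g)) = g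
  exists_inv : ∀ g, ∃ h, src h = tgt g ∧ tgt h = src g ∧
    mul g h = unit (tgt g) ∧ mul h g = unit (src g)

namespace GroupoidOver

/-- `Γ ⇉ B` is a Lie groupoid: source and target are submersions, the units are embedded, and the
multiplication is smooth on the set of composable pairs. -/
structure IsLie {E : Type*} [NormedAddCommGroup E] [NormedSpace ℝ E] {H : Type*}
    [TopologicalSpace H] (I : ModelWithCorners ℝ E H)
    {E' : Type*} [NormedAddCommGroup E'] [NormedSpace ℝ E'] {H' : Type*} [TopologicalSpace H']
    (J : ModelWithCorners ℝ E' H')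
    {Γ : Type*} [TopologicalSpace Γ] [ChartedSpace H Γ]
    {B : Type*} [TopologicalSpace B] [ChartedSpace H' B] (𝒢 : GroupoidOver Γ B) : Prop where
  src : IsSmoothSubmersion I J 𝒢.src
  tgt : IsSmoothSubmersion I J 𝒢.tgt
  unit : IsSmoothEmb J I 𝒢.unit
  mul : ContMDiffOn (I.prod I) I ∞ (fun p : Γ × Γ => 𝒢.mul p.1 p.2)
    {p | 𝒢.src p.1 = 𝒢.tgt p.2}

end GroupoidOver

/-- A finite-dimensional smooth manifold without boundary, bundled. No separation or countability
axiom is included: below these manifolds occur as embedded submanifolds, and inherit both. -/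
structure SmoothMfld.{a, b, c} where
  carrier : Type c
  E : Type a
  H : Type b
  [normedAddCommGroup : NormedAddCommGroup E]
  [normedSpace : NormedSpace ℝ E]
  [finiteDimensional : FiniteDimensional ℝ E]
  [topH : TopologicalSpace H]
  model : ModelWithCorners ℝ E H
  [boundaryless : model.Boundaryless]
  [top : TopologicalSpace carrier]
  [charted : ChartedSpace H carrier]
  [isManifold : IsManifold model ∞ carrier]

attribute [instance] SmoothMfld.normedAddCommGroup SmoothMfld.normedSpace
  SmoothMfld.finiteDimensional SmoothMfld.topH SmoothMfld.boundaryless SmoothMfld.top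
  SmoothMfld.charted SmoothMfld.isManifold

namespace GroupoidOver

/-- A subset `S` of the arrows of `𝒢 : Γ ⇉ B` is (the set of arrows of) a Lie subgroupoid: it is an
embedded submanifold, and there is a Lie groupoid structure on it, over an embedded submanifold
of `B`, such that the inclusion is a morphism of groupoids. -/
def IsLieSubgroupoid.{a, b, c, a', b', c'} {E : Type a} [NormedAddCommGroup E] [NormedSpace ℝ E]
    {H : Type b} [TopologicalSpace H] (I : ModelWithCorners ℝ E H)
    {E' : Type a'} [NormedAddCommGroup E'] [NormedSpace ℝ E'] {H' : Type b'} [TopologicalSpace H']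
    (J : ModelWithCorners ℝ E' H')
    {Γ : Type c} [TopologicalSpace Γ] [ChartedSpace H Γ]
    {B : Type c'} [TopologicalSpace B] [ChartedSpace H' B]
    (𝒢 : GroupoidOver Γ B) (S : Set Γ) : Prop :=
  ∃ (A : SmoothMfld.{a, b, c}) (C : SmoothMfld.{a', b', c'})
    (𝓗 : GroupoidOver A.carrier C.carrier) (i : A.carrier → Γ) (j : C.carrier → B),
    𝓗.IsLie A.model C.model ∧
    IsSmoothEmb A.model I i ∧ IsSmoothEmb C.model J j ∧ Set.range i = S ∧
    (∀ g, 𝒢.src (i g) = j (𝓗.src g)) ∧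
    (∀ g, 𝒢.tgt (i g) = j (𝓗.tgt g)) ∧
    (∀ c, i (𝓗.unit c) = 𝒢.unit (j c)) ∧
    (∀ g h, 𝓗.src g = 𝓗.tgt h → i (𝓗.mul g h) = 𝒢.mul (i g) (i h))

/-- An action of a groupoid `Γ ⇉ B` on `P` along `moment : P → B`. The value `act g p` is `g ∘ p`
when `src g = moment p`; other values carry no meaning. -/
structure Action {Γ B : Type*} (𝒢 : GroupoidOver Γ B) (P : Type*) where
  moment : P → B
  act : Γ → P → P
  moment_act : ∀ g p, 𝒢.src g = moment p → moment (act g p) = 𝒢.tgt g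
  mul_act : ∀ g h p, 𝒢.src g = 𝒢.tgt h → 𝒢.src h = moment p →
    act (𝒢.mul g h) p = act g (act h p)
  unit_act : ∀ p, act (𝒢.unit (moment p)) p = p

/-- The action of `Γ ⇉ B` on `P` restricts to an action of the subgroupoid with arrows `S ⊆ Γ` on
the subset `Q ⊆ P`. -/
def Action.RestrictsTo {Γ B P : Type*} {𝒢 : GroupoidOver Γ B} (α : 𝒢.Action P)
    (S : Set Γ) (Q : Set P) : Prop :=
  ∀ x ∈ S, ∀ y ∈ Q, 𝒢.src x = α.moment y → α.act x y ∈ Q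

end GroupoidOver

/-! ### Poisson structures -/

section Poisson

variable {E : Type*} [NormedAddCommGroup E] [NormedSpace ℝ E] {H : Type*} [TopologicalSpace H]
  (I : ModelWithCorners ℝ E H)
  {E' : Type*} [NormedAddCommGroup E'] [NormedSpace ℝ E'] {H' : Type*} [TopologicalSpace H']
  (J : ModelWithCorners ℝ E' H')

/-- The cotangent space `T*_m M`. -/
abbrev CotSpace {M : Type*} [TopologicalSpace M] [ChartedSpace H M] (m : M) :=
  TangentSpace I m →L[ℝ] ℝ

/-- A contravariant 2-tensor field `π` on a (finite-dimensional) manifold, given as the field of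
linear maps `π♯ : T*_m M → T_m M`, so that `π(μ, ν) = ν (π♯ μ)`. -/
abbrev TensorField2 (M : Type*) [TopologicalSpace M] [ChartedSpace H M] :=
  ∀ m : M, CotSpace I m →L[ℝ] TangentSpace I m

variable {M : Type*} [TopologicalSpace M] [ChartedSpace H M]
  {N : Type*} [TopologicalSpace N] [ChartedSpace H' N]

/-- The differential of a real-valued function, as a covector. -/
def dFun (f : M → ℝ) (m : M) : CotSpace I m := mfderiv I 𝓘(ℝ, ℝ) f m

variable {I J}

/-- The bracket `{f, g} = π(df, dg)`. -/
def TensorField2.bracket (P : TensorField2 I M) (f g : M → ℝ) (m : M) : ℝ :=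
  dFun I g m (P m (dFun I f m))

/-- `P` (with `P = π♯`) is a Poisson structure on `M`: a smooth bivector field whose bracket on `C^∞(M)` satisfies
the Jacobi identity. -/
structure TensorField2.IsPoisson [IsManifold I ∞ M] (P : TensorField2 I M) : Prop where
  smooth : ContMDiff I (I.prod 𝓘(ℝ, (E →L[ℝ] ℝ) →L[ℝ] E)) ∞
    (fun m => TotalSpace.mk' ((E →L[ℝ] ℝ) →L[ℝ] E) m (P m))
  skew : ∀ (m : M) (μ ν : CotSpace I m), ν (P m μ) = - μ (P m ν)
  jacobi : ∀ f g h : M → ℝ, ContMDiff I 𝓘(ℝ, ℝ) ∞ f → ContMDiff I 𝓘(ℝ, ℝ) ∞ g →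
    ContMDiff I 𝓘(ℝ, ℝ) ∞ h →
    P.bracket f (P.bracket g h) = P.bracket (P.bracket f g) h + P.bracket g (P.bracket f h)

/-- The product `π ⊕ π'` on `M × N`: a covector `ξ` on `T_m M × T_n N` is sent to
`(π♯ (ξ|_{T_m M}), π'♯ (ξ|_{T_n N}))`. -/
def TensorField2.prod (P : TensorField2 I M) (P' : TensorField2 J N) :
    TensorField2 (I.prod J) (M × N) := fun p =>
  show ((E × E') →L[ℝ] ℝ) →L[ℝ] E × E' from
    ((P p.1 : (E →L[ℝ] ℝ) →L[ℝ] E).comp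
      (ContinuousLinearMap.precomp ℝ (ContinuousLinearMap.inl ℝ E E'))).prod
    ((P' p.2 : (E' →L[ℝ] ℝ) →L[ℝ] E').comp
      (ContinuousLinearMap.precomp ℝ (ContinuousLinearMap.inr ℝ E E')))

/-- `F : N → M` is a Poisson map: it is smooth and `F^* : C^∞(M) → C^∞(N)` preserves brackets. -/
structure IsPoissonMap (PN : TensorField2 J N) (PM : TensorField2 I M) (F : N → M) : Prop where
  contMDiff : ContMDiff J I ∞ F
  bracket_comp : ∀ f g : M → ℝ, ContMDiff I 𝓘(ℝ, ℝ) ∞ f → ContMDiff I 𝓘(ℝ, ℝ) ∞ g →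
    PN.bracket (f ∘ F) (g ∘ F) = PM.bracket f g ∘ F

/-- `P` is a Poisson Lie group structure on `G`: it is a Poisson structure and the multiplication
`G × G → G` is a Poisson map. -/
structure IsPoissonLieGroup {G : Type*} [TopologicalSpace G] [ChartedSpace H G] [Group G]
    [LieGroup I ∞ G] (P : TensorField2 I G) : Prop where
  isPoisson : P.IsPoisson
  isPoissonMap_mul : IsPoissonMap (P.prod P) P (fun p : G × G => p.1 * p.2)

variable (I M) in
/-- The total space of `𝕋M = TM ⊕ T*M`. A point is a base point `x.1` with a pair
`x.2 = (v, μ)`, standing for `v + μ`. -/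
abbrev GenTangent := TotalSpace (E × (E →L[ℝ] ℝ)) fun m : M => TangentSpace I m × CotSpace I m

/-- The graph `Gr(π) = {π♯(μ) + μ} ⊆ 𝕋M`. -/
def TensorField2.graph (P : TensorField2 I M) : Set (GenTangent I M) :=
  {x | x.2.1 = P x.1 x.2.2}

end Poisson

/-! ### The groupoid `𝕋G ⇉ 𝔤*` and its action on `𝕋M` -/

section LieGroupoidTG

/-- The dual `𝔤*` of the Lie algebra `𝔤 = T_e G`. As a manifold it is the vector space `𝔤*` (recall
that `T_e G` is, by definition, the model space `E`). -/
def LieDual {E : Type*} [NormedAddCommGroup E] [NormedSpace ℝ E] {H : Type*} [TopologicalSpace H]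
    (I : ModelWithCorners ℝ E H) (G : Type*) [TopologicalSpace G] [ChartedSpace H G] [Group G] :
    Type _ :=
  CotSpace I (1 : G)

variable {E : Type*} [NormedAddCommGroup E] [NormedSpace ℝ E] {H : Type*} [TopologicalSpace H]
  (I : ModelWithCorners ℝ E H)
  {E' : Type*} [NormedAddCommGroup E'] [NormedSpace ℝ E'] {H' : Type*} [TopologicalSpace H']
  (J : ModelWithCorners ℝ E' H')
  (G : Type*) [TopologicalSpace G] [ChartedSpace H G] [Group G]
  (M : Type*) [TopologicalSpace M] [ChartedSpace H' M]

instance : NormedAddCommGroup (LieDual I G) := inferInstanceAs (NormedAddCommGroup (E →L[ℝ] ℝ))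
instance : NormedSpace ℝ (LieDual I G) := inferInstanceAs (NormedSpace ℝ (E →L[ℝ] ℝ))

variable {G M}

/-- The source of `v + μ ∈ 𝕋_g G`: the left trivialization `μ ∘ T_e L_g` of `μ`. -/
def genSrc (x : GenTangent I G) : LieDual I G :=
  show E →L[ℝ] ℝ from
    (x.2.2 : E →L[ℝ] ℝ) ∘L (mfderiv I I (fun a : G => x.1 * a) 1 : E →L[ℝ] E)

/-- The target of `v + μ ∈ 𝕋_g G`: the right trivialization `μ ∘ T_e R_g` of `μ`. -/
def genTgt (x : GenTangent I G) : LieDual I G :=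
  show E →L[ℝ] ℝ from
    (x.2.2 : E →L[ℝ] ℝ) ∘L (mfderiv I I (fun a : G => a * x.1) 1 : E →L[ℝ] E)

/-- The unit at `ν ∈ 𝔤*`: the element `0 + ν ∈ 𝕋_e G`. -/
def genUnit (ν : LieDual I G) : GenTangent I G := ⟨1, (0, ν)⟩

/-- The product `(v₁ + μ₁) ∘ (v₂ + μ₂) = v + μ` over `g = g₁ g₂`, with `v = (Mult)_*(v₁, v₂)` and
`μ = μ₂ ∘ (T L_{g₁})⁻¹`. For composable elements this `μ` is the unique covector with
`(Mult)^* μ = (μ₁, μ₂)`, see `genMul_eq_iff`. -/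
def genMul (x y : GenTangent I G) : GenTangent I G :=
  ⟨x.1 * y.1, (mfderiv (I.prod I) I (fun p : G × G => p.1 * p.2) (x.1, y.1) (x.2.1, y.2.1),
    y.2.2 ∘L (mfderiv I I (fun a : G => x.1 * a) y.1).inverse)⟩

variable [MulAction G M]

variable (G) in
/-- The moment map `Φ(w + ν)(ξ) = ν(ξ_M)`, with `ξ_M(m) ∈ T_m M` the image of `ξ ∈ 𝔤` under the
differential at `e` of `g ↦ g • m`. -/
def genMoment (y : GenTangent J M) : LieDual I G :=
  show E →L[ℝ] ℝ from
    (y.2.2 : E' →L[ℝ] ℝ) ∘L (mfderiv I J (fun a : G => a • y.1) 1 : E →L[ℝ] E')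

/-- The action `(v + μ) ∘ (w + ν) = w' + ν'` over `g • m`, with `w' = 𝒜_*(v, w)` for the action map
`𝒜 : G × M → M` and `ν' = ν ∘ (T_m 𝒜_g)⁻¹`. When it is defined, this `ν'` is the unique covector
with `𝒜^* ν' = (μ, ν)`, see `genAct_eq_iff`. -/
def genAct (x : GenTangent I G) (y : GenTangent J M) : GenTangent J M :=
  ⟨x.1 • y.1, (mfderiv (I.prod J) J (fun p : G × M => p.1 • p.2) (x.1, y.1) (x.2.1, y.2.1),
    y.2.2 ∘L (mfderiv J J (fun a : M => x.1 • a) y.1).inverse)⟩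

end LieGroupoidTG

section Aux

variable {E : Type*} [NormedAddCommGroup E] [NormedSpace ℝ E] {H : Type*} [TopologicalSpace H]
  (I : ModelWithCorners ℝ E H)
  {E' : Type*} [NormedAddCommGroup E'] [NormedSpace ℝ E'] {H' : Type*} [TopologicalSpace H']
  (J : ModelWithCorners ℝ E' H')
  {E'' : Type*} [NormedAddCommGroup E''] [NormedSpace ℝ E''] {H'' : Type*} [TopologicalSpace H'']
  (K : ModelWithCorners ℝ E'' H'')
  {M : Type*} [TopologicalSpace M] [ChartedSpace H M]
  {N : Type*} [TopologicalSpace N] [ChartedSpace H' N]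
  {Q : Type*} [TopologicalSpace Q] [ChartedSpace H'' Q]

/-- The differential of `f` at `x`, as a map between the model spaces. -/
def modelDeriv (f : M → N) (x : M) : E →L[ℝ] E' := mfderiv I J f x

variable {I J K}

lemma modelDeriv_comp {g : N → Q} {f : M → N} (hg : ContMDiff J K ∞ g) (hf : ContMDiff I J ∞ f)
    (x : M) (v : E) :
    modelDeriv J K g (f x) (modelDeriv I J f x v) = modelDeriv I K (fun y => g (f y)) x v := by
  have h := mfderiv_comp x (hg.mdifferentiableAt (by simp) : MDifferentiableAt J K g (f x))
    (hf.mdifferentiableAt (by simp))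
  exact (DFunLike.congr_fun h v).symm

lemma modelDeriv_id (x : M) (v : E) : modelDeriv I I (fun y : M => y) x v = v :=
  DFunLike.congr_fun (mfderiv_id (I := I) (x := x)) v

lemma mfderiv_pair {f : M × N → Q} (hf : ContMDiff (I.prod J) K ∞ f) (x : M) (y : N)
    (v : TangentSpace I x) (w : TangentSpace J y) :
    mfderiv (I.prod J) K f (x, y) (v, w) =
      modelDeriv I K (fun z => f (z, y)) x v + modelDeriv J K (fun z => f (x, z)) y w :=
  mfderiv_prod_eq_add_apply (p := (x, y)) (hf.mdifferentiableAt (by simp))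

lemma genTangent_ext {x y : GenTangent I M} (h₁ : x.1 = y.1) (h₂ : (x.2.1 : E) = y.2.1)
    (h₃ : ∀ v : E, (x.2.2 : E →L[ℝ] ℝ) v = (y.2.2 : E →L[ℝ] ℝ) v) : x = y := by
  obtain ⟨x, v, μ⟩ := x
  obtain ⟨y, w, ν⟩ := y
  obtain rfl : x = y := h₁
  obtain rfl : v = w := h₂
  obtain rfl : μ = ν := ContinuousLinearMap.ext h₃
  rfl

variable {G : Type*} [TopologicalSpace G] [ChartedSpace H G] [Group G] [MulAction G N]

lemma contMDiff_act (I : ModelWithCorners ℝ E H) [ContMDiffSMul I J ∞ G N] (g : G) : ContMDiff J J ∞ (fun a : N => g • a) :=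
  ContMDiffSMul.contMDiff_const_smul (I := I) g

lemma contMDiff_orbit [ContMDiffSMul I J ∞ G N] (m : N) : ContMDiff I J ∞ (fun a : G => a • m) :=
  (contMDiff_smul (I := I) (I' := J) (n := ∞) (G := G) (M := N)).comp
    (contMDiff_id.prodMk contMDiff_const)

lemma inverse_mfderiv_act (I : ModelWithCorners ℝ E H) [ContMDiffSMul I J ∞ G N] (g : G) (m : N)
    (w : E') :
    ((mfderiv J J (fun a : N => g • a) m).inverse : E' →L[ℝ] E') w =
      modelDeriv J J (fun a : N => g⁻¹ • a) (g • m) w := by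
  have key : (modelDeriv J J (fun a : N => g • a) m).inverse =
      modelDeriv J J (fun a : N => g⁻¹ • a) (g • m) := by
    apply ContinuousLinearMap.inverse_eq
    · ext v
      have h := modelDeriv_comp (contMDiff_act (J := J) (N := N) I g)
        (contMDiff_act (J := J) (N := N) I g⁻¹) (g • m) v
      simp only [inv_smul_smul, smul_inv_smul] at h
      exact h.trans (modelDeriv_id _ _)
    · ext v
      have h := modelDeriv_comp (contMDiff_act (J := J) (N := N) I g⁻¹)
        (contMDiff_act (J := J) (N := N) I g) m v
      simp only [inv_smul_smul] at h
      exact h.trans (modelDeriv_id _ _)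
  exact DFunLike.congr_fun key w

/-- An element of `𝔤*` as a functional on the model space. -/
def LieDual.toCLM (ν : LieDual I G) : E →L[ℝ] ℝ := ν

lemma genAct_vec [ContMDiffSMul I J ∞ G N] (x : GenTangent I G) (y : GenTangent J N) :
    ((genAct I J x y).2.1 : E') = modelDeriv I J (fun a : G => a • y.1) x.1 x.2.1 +
      modelDeriv J J (fun a : N => x.1 • a) y.1 y.2.1 :=
  mfderiv_pair (contMDiff_smul (I := I) (I' := J) (n := ∞) (G := G) (M := N)) x.1 y.1 x.2.1 y.2.1

lemma genAct_covec [ContMDiffSMul I J ∞ G N] (x : GenTangent I G) (y : GenTangent J N) (w : E') :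
    ((genAct I J x y).2.2 : E' →L[ℝ] ℝ) w =
      (y.2.2 : E' →L[ℝ] ℝ) (modelDeriv J J (fun a : N => x.1⁻¹ • a) (x.1 • y.1) w) :=
  congrArg (y.2.2 : E' →L[ℝ] ℝ) (inverse_mfderiv_act I x.1 y.1 w)

lemma genAct_assoc [LieGroup I ∞ G] [ContMDiffSMul I J ∞ G N] (x y : GenTangent I G)
    (z : GenTangent J N) :
    genAct I J (genMul I x y) z = genAct I J x (genAct I J y z) := by
  change genAct I J (genAct I I x y) z = _
  refine genTangent_ext (mul_smul x.1 y.1 z.1) ?_ fun v => ?_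
  · rw [genAct_vec, genAct_vec, genAct_vec, genAct_vec]
    have e1 := modelDeriv_comp (contMDiff_orbit (I := I) (J := J) (G := G) z.1)
      (contMDiff_orbit (I := I) (J := I) (G := G) y.1) x.1 x.2.1
    have e2 := modelDeriv_comp (contMDiff_orbit (I := I) (J := J) (G := G) z.1)
      (contMDiff_act (J := I) (N := G) I x.1) y.1 y.2.1
    have e3 := modelDeriv_comp (contMDiff_act (J := J) (N := N) I x.1)
      (contMDiff_orbit (I := I) (J := J) (G := G) z.1) y.1 y.2.1
    have e4 := modelDeriv_comp (contMDiff_act (J := J) (N := N) I x.1)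
      (contMDiff_act (J := J) (N := N) I y.1) z.1 z.2.1
    simp only [smul_eq_mul, mul_smul] at e1 e2 e3 e4
    rw [map_add, map_add]
    change modelDeriv I J (fun a : G => a • z.1) (x.1 * y.1)
        (modelDeriv I I (fun a : G => a * y.1) x.1 x.2.1) +
      modelDeriv I J (fun a : G => a • z.1) (x.1 * y.1)
        (modelDeriv I I (fun a : G => x.1 * a) y.1 y.2.1) +
      modelDeriv J J (fun a : N => (x.1 * y.1) • a) z.1 z.2.1 =
      modelDeriv I J (fun a : G => a • y.1 • z.1) x.1 x.2.1 +
      (modelDeriv J J (fun a : N => x.1 • a) (y.1 • z.1)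
        (modelDeriv I J (fun a : G => a • z.1) y.1 y.2.1) +
      modelDeriv J J (fun a : N => x.1 • a) (y.1 • z.1)
        (modelDeriv J J (fun a : N => y.1 • a) z.1 z.2.1))
    rw [e1, e2, e3, e4, add_assoc]
    simp only [mul_smul]
  · rw [genAct_covec, genAct_covec, genAct_covec]
    have k := modelDeriv_comp (contMDiff_act (J := J) (N := N) I y.1⁻¹)
        (contMDiff_act (J := J) (N := N) I x.1⁻¹) (x.1 • y.1 • z.1) v
    simp only [inv_smul_smul] at k
    change (z.2.2 : E' →L[ℝ] ℝ) (modelDeriv J J (fun a : N => (x.1 * y.1)⁻¹ • a)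
        ((x.1 * y.1) • z.1) v) = (z.2.2 : E' →L[ℝ] ℝ)
          (modelDeriv J J (fun a : N => y.1⁻¹ • a) (y.1 • z.1)
            (modelDeriv J J (fun a : N => x.1⁻¹ • a) (x.1 • y.1 • z.1) v))
    rw [k]
    simp only [mul_inv_rev, mul_smul]

lemma genMoment_genAct [LieGroup I ∞ G] [ContMDiffSMul I J ∞ G N] (x : GenTangent I G)
    (y : GenTangent J N) (h : genSrc I x = genMoment I J G y) :
    genMoment I J G (genAct I J x y) = genTgt I x := by
  -- `μ = ν ∘ T(x⁻¹ • ·) ∘ T(orbit)` as covectors at `x.1`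
  have hv : ∀ ξ : E, (x.2.2 : E →L[ℝ] ℝ) (modelDeriv I I (fun a : G => x.1 * a) 1 ξ) =
      (y.2.2 : E' →L[ℝ] ℝ) (modelDeriv I J (fun a : G => a • y.1) 1 ξ) :=
    fun ξ => DFunLike.congr_fun (F := E →L[ℝ] ℝ) h ξ
  refine ContinuousLinearMap.ext (M₁ := E) (M₂ := ℝ) fun ξ => ?_
  change ((genAct I J x y).2.2 : E' →L[ℝ] ℝ)
      (modelDeriv I J (fun a : G => a • x.1 • y.1) 1 ξ) =
    (x.2.2 : E →L[ℝ] ℝ) (modelDeriv I I (fun a : G => a * x.1) 1 ξ)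
  rw [genAct_covec]
  -- `T R_g ξ = T L_g (Ad_{g⁻¹} ξ)`
  have e1 := modelDeriv_comp (contMDiff_act (J := I) (N := G) I x.1)
    ((contMDiff_act (J := I) (N := G) I x.1⁻¹).comp
      (contMDiff_orbit (I := I) (J := I) (G := G) x.1)) 1 ξ
  have e2 := modelDeriv_comp (contMDiff_orbit (I := I) (J := J) (G := G) y.1)
    ((contMDiff_act (J := I) (N := G) I x.1⁻¹).comp
      (contMDiff_orbit (I := I) (J := I) (G := G) x.1)) 1 ξ
  have e3 := modelDeriv_comp (contMDiff_act (J := J) (N := N) I x.1⁻¹)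
    (contMDiff_orbit (I := I) (J := J) (G := G) (x.1 • y.1)) 1 ξ
  simp only [Function.comp_apply, smul_eq_mul, one_mul, inv_mul_cancel, mul_inv_cancel_left,
    mul_smul, one_smul] at e1 e2 e3
  rw [e3, ← e2, ← e1, hv]

/-- The action in relational form: `x ∘ y` is defined and equal to `w' + ν'` if and only if
`w' = 𝒜_*(v, w)` and `𝒜^* ν' = (μ, ν)`. -/
lemma genAct_eq_iff [LieGroup I ∞ G] [ContMDiffSMul I J ∞ G N] (x : GenTangent I G)
    (y : GenTangent J N) (w' : TangentSpace J (x.1 • y.1)) (ν' : CotSpace J (x.1 • y.1)) :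
    (genSrc I x = genMoment I J G y ∧
      genAct I J x y = ⟨x.1 • y.1, (w', ν')⟩) ↔
    w' = mfderiv (I.prod J) J (fun p : G × N => p.1 • p.2) (x.1, y.1) (x.2.1, y.2.1) ∧
    ∀ (a : TangentSpace I x.1) (b : TangentSpace J y.1),
      ν' (mfderiv (I.prod J) J (fun p : G × N => p.1 • p.2) (x.1, y.1) (a, b)) =
        x.2.2 a + y.2.2 b := by
  have hs : ContMDiff (I.prod J) J ∞ (fun p : G × N => p.1 • p.2) := contMDiff_smul
  have hL : ∀ b : E', modelDeriv J J (fun a : N => x.1⁻¹ • a) (x.1 • y.1)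
      (modelDeriv J J (fun a : N => x.1 • a) y.1 b) = b := fun b => by
    have k := modelDeriv_comp (contMDiff_act (J := J) (N := N) I x.1⁻¹)
      (contMDiff_act (J := J) (N := N) I x.1) y.1 b
    simp only [inv_smul_smul, modelDeriv_id] at k
    exact k
  have hR : ∀ b : E', modelDeriv J J (fun a : N => x.1 • a) y.1
      (modelDeriv J J (fun a : N => x.1⁻¹ • a) (x.1 • y.1) b) = b := fun b => by
    have k := modelDeriv_comp (contMDiff_act (J := J) (N := N) I x.1)
      (contMDiff_act (J := J) (N := N) I x.1⁻¹) (x.1 • y.1) b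
    simp only [smul_inv_smul, inv_smul_smul, modelDeriv_id] at k
    exact k
  have hO : ∀ ξ : E, modelDeriv I J (fun a : G => a • y.1) x.1
      (modelDeriv I I (fun a : G => x.1 * a) 1 ξ) =
      modelDeriv J J (fun a : N => x.1 • a) y.1 (modelDeriv I J (fun a : G => a • y.1) 1 ξ) :=
    fun ξ => by
    have e2 := modelDeriv_comp (contMDiff_orbit (I := I) (J := J) (G := G) y.1)
      (contMDiff_act (J := I) (N := G) I x.1) 1 ξ
    have e3 := modelDeriv_comp (contMDiff_act (J := J) (N := N) I x.1)
      (contMDiff_orbit (I := I) (J := J) (G := G) y.1) 1 ξ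
    simp only [smul_eq_mul, mul_one, mul_smul, one_smul] at e2 e3
    rw [e2, e3]
  have hI : ∀ v : E, modelDeriv I I (fun a : G => x.1 * a) 1
      (modelDeriv I I (fun a : G => x.1⁻¹ * a) x.1 v) = v := fun v => by
    have k := modelDeriv_comp (contMDiff_act (J := I) (N := G) I x.1)
      (contMDiff_act (J := I) (N := G) I x.1⁻¹) x.1 v
    simp only [smul_eq_mul, mul_inv_cancel_left, inv_mul_cancel, modelDeriv_id] at k
    exact k
  constructor
  · rintro ⟨hc, he⟩
    have hv : ∀ ξ : E, (x.2.2 : E →L[ℝ] ℝ) (modelDeriv I I (fun a : G => x.1 * a) 1 ξ) =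
        (y.2.2 : E' →L[ℝ] ℝ) (modelDeriv I J (fun a : G => a • y.1) 1 ξ) :=
      fun ξ => DFunLike.congr_fun (F := E →L[ℝ] ℝ) hc ξ
    have h2 := eq_of_heq (TotalSpace.mk.inj he).2
    have hw := (Prod.mk.inj h2).1
    have hν := (Prod.mk.inj h2).2
    refine ⟨hw.symm, fun a b => ?_⟩
    subst hν
    refine (genAct_covec x y _).trans ?_
    refine (congrArg (fun u : E' => (y.2.2 : E' →L[ℝ] ℝ)
      (modelDeriv J J (fun a : N => x.1⁻¹ • a) (x.1 • y.1) u))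
      (mfderiv_pair hs x.1 y.1 a b)).trans ?_
    refine (congrArg (y.2.2 : E' →L[ℝ] ℝ) (map_add _ (_ : E') (_ : E'))).trans ?_
    refine (map_add (y.2.2 : E' →L[ℝ] ℝ) (_ : E') (_ : E')).trans ?_
    refine congrArg₂ (· + ·) ?_ (congrArg (y.2.2 : E' →L[ℝ] ℝ) (hL b))
    have := hv (modelDeriv I I (fun a : G => x.1⁻¹ * a) x.1 a)
    refine Eq.trans ?_ (this.symm.trans (congrArg (x.2.2 : E →L[ℝ] ℝ) (hI a)))
    refine congrArg (y.2.2 : E' →L[ℝ] ℝ) ?_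
    refine (congrArg (fun u : E => modelDeriv J J (fun a : N => x.1⁻¹ • a) (x.1 • y.1)
      (modelDeriv I J (fun a : G => a • y.1) x.1 u)) (hI a).symm).trans ?_
    exact (congrArg (modelDeriv J J (fun a : N => x.1⁻¹ • a) (x.1 • y.1)) (hO _)).trans (hL _)
  · rintro ⟨hw, hν⟩
    have hν' : ∀ (a : E) (b : E'), (ν' : E' →L[ℝ] ℝ)
        (modelDeriv I J (fun a : G => a • y.1) x.1 a +
          modelDeriv J J (fun a : N => x.1 • a) y.1 b) =
        (x.2.2 : E →L[ℝ] ℝ) a + (y.2.2 : E' →L[ℝ] ℝ) b := fun a b =>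
      (congrArg (ν' : E' →L[ℝ] ℝ) (mfderiv_pair hs x.1 y.1 a b)).symm.trans (hν a b)
    have h1 : ∀ a : E, (ν' : E' →L[ℝ] ℝ) (modelDeriv I J (fun a : G => a • y.1) x.1 a) =
        (x.2.2 : E →L[ℝ] ℝ) a := fun a => by
      have h0 := hν' a 0
      rw [map_zero, add_zero] at h0
      exact h0.trans ((congrArg (_ + ·) (map_zero (y.2.2 : E' →L[ℝ] ℝ))).trans (add_zero _))
    have h2 : ∀ b : E', (ν' : E' →L[ℝ] ℝ) (modelDeriv J J (fun a : N => x.1 • a) y.1 b) =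
        (y.2.2 : E' →L[ℝ] ℝ) b := fun b => by
      have h0 := hν' 0 b
      rw [map_zero, zero_add] at h0
      exact h0.trans ((congrArg (· + _) (map_zero (x.2.2 : E →L[ℝ] ℝ))).trans (zero_add _))
    refine ⟨ContinuousLinearMap.ext (M₁ := E) (M₂ := ℝ) fun ξ => ?_,
      genTangent_ext rfl hw.symm fun v => ?_⟩
    · change (x.2.2 : E →L[ℝ] ℝ) (modelDeriv I I (fun a : G => x.1 * a) 1 ξ) =
        (y.2.2 : E' →L[ℝ] ℝ) (modelDeriv I J (fun a : G => a • y.1) 1 ξ)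
      rw [← h1, ← h2, hO]
    · rw [genAct_covec, ← h2, hR]

/-- The multiplication in relational form: `x ∘ y` is defined and equal to `v + μ` if and only if
`v = (Mult)_*(v₁, v₂)` and `(Mult)^* μ = (μ₁, μ₂)`. -/
lemma genMul_eq_iff [LieGroup I ∞ G] (x y : GenTangent I G)
    (v : TangentSpace I (x.1 * y.1)) (μ : CotSpace I (x.1 * y.1)) :
    (genSrc I x = genTgt I y ∧ genMul I x y = ⟨x.1 * y.1, (v, μ)⟩) ↔
    v = mfderiv (I.prod I) I (fun p : G × G => p.1 * p.2) (x.1, y.1) (x.2.1, y.2.1) ∧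
    ∀ (a : TangentSpace I x.1) (b : TangentSpace I y.1),
      μ (mfderiv (I.prod I) I (fun p : G × G => p.1 * p.2) (x.1, y.1) (a, b)) =
        x.2.2 a + y.2.2 b :=
  genAct_eq_iff (N := G) x y v μ

lemma genUnit_act [LieGroup I ∞ G] [ContMDiffSMul I J ∞ G N] (y : GenTangent J N)
    (ν : LieDual I G) : genAct I J (genUnit I ν) y = y := by
  refine genTangent_ext (one_smul G y.1) ?_ fun w => ?_
  · rw [genAct_vec]
    change modelDeriv I J (fun a : G => a • y.1) 1 (0 : E) +
      modelDeriv J J (fun a : N => (1 : G) • a) y.1 y.2.1 = _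
    simp only [one_smul, map_zero, zero_add]
    exact modelDeriv_id _ _
  · rw [genAct_covec]
    change (y.2.2 : E' →L[ℝ] ℝ) (modelDeriv J J (fun a : N => (1 : G)⁻¹ • a) ((1 : G) • y.1) w) = _
    simp only [inv_one, one_smul, modelDeriv_id]

lemma genSrc_genMul [LieGroup I ∞ G] (x y : GenTangent I G) :
    genSrc I (genMul I x y) = genSrc I y := by
  refine ContinuousLinearMap.ext (M₁ := E) (M₂ := ℝ) fun ξ => ?_
  refine (genAct_covec (N := G) x y _).trans ?_
  change (y.2.2 : E →L[ℝ] ℝ) (modelDeriv I I (fun a : G => x.1⁻¹ * a) (x.1 * y.1)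
    (modelDeriv I I (fun a : G => x.1 * y.1 * a) 1 ξ)) =
    (y.2.2 : E →L[ℝ] ℝ) (modelDeriv I I (fun a : G => y.1 * a) 1 ξ)
  have k := modelDeriv_comp (contMDiff_act (J := I) (N := G) I x.1⁻¹)
    (contMDiff_act (J := I) (N := G) I (x.1 * y.1)) 1 ξ
  simp only [smul_eq_mul, mul_assoc, inv_mul_cancel_left, mul_one] at k
  simp only [mul_assoc]
  rw [k]

lemma genMul_unit [LieGroup I ∞ G] (x : GenTangent I G) :
    genMul I x (genUnit I (genSrc I x)) = x := by
  refine genTangent_ext (mul_one x.1) ?_ fun w => ?_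
  · refine (genAct_vec (N := G) x _).trans ?_
    change modelDeriv I I (fun a : G => a * 1) x.1 x.2.1 +
      modelDeriv I I (fun a : G => x.1 * a) 1 (0 : E) = _
    simp only [mul_one, map_zero, add_zero]
    exact modelDeriv_id _ _
  · refine (genAct_covec (N := G) x _ w).trans ?_
    change (x.2.2 : E →L[ℝ] ℝ) (modelDeriv I I (fun a : G => x.1 * a) 1
      (modelDeriv I I (fun a : G => x.1⁻¹ * a) (x.1 * 1) w)) = _
    have k := modelDeriv_comp (contMDiff_act (J := I) (N := G) I x.1)
      (contMDiff_act (J := I) (N := G) I x.1⁻¹) (x.1 * 1) w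
    simp only [smul_eq_mul, mul_inv_cancel_left, inv_mul_cancel, mul_one, modelDeriv_id] at k
    simp only [mul_one]
    rw [k]

lemma genSrc_genUnit [LieGroup I ∞ G] (ν : LieDual I G) : genSrc I (genUnit I ν) = ν := by
  refine ContinuousLinearMap.ext (M₁ := E) (M₂ := ℝ) fun ξ => ?_
  change ν.toCLM (modelDeriv I I (fun a : G => 1 * a) 1 ξ) = ν.toCLM ξ
  simp only [one_mul, modelDeriv_id]

lemma genTgt_genUnit [LieGroup I ∞ G] (ν : LieDual I G) : genTgt I (genUnit I ν) = ν := by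
  refine ContinuousLinearMap.ext (M₁ := E) (M₂ := ℝ) fun ξ => ?_
  change ν.toCLM (modelDeriv I I (fun a : G => a * 1) 1 ξ) = ν.toCLM ξ
  simp only [mul_one, modelDeriv_id]

lemma genMul_exists_right_inv [LieGroup I ∞ G] (x : GenTangent I G) :
    ∃ y, genTgt I y = genSrc I x ∧ genSrc I y = genTgt I x ∧
      genMul I x y = genUnit I (genTgt I x) := by
  let v : E := x.2.1
  let w : E := -modelDeriv I I (fun a : G => x.1⁻¹ * a) 1
    (modelDeriv I I (fun a : G => a * x.1⁻¹) x.1 v)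
  let κ : E →L[ℝ] ℝ := (genTgt I x).toCLM ∘L modelDeriv I I (fun a : G => x.1 * a) x.1⁻¹
  let y : GenTangent I G := ⟨x.1⁻¹, (w, κ)⟩
  have hxy : genMul I x y = genUnit I (genTgt I x) := by
    refine genTangent_ext (mul_inv_cancel x.1) ?_ fun u => ?_
    · refine (genAct_vec (N := G) x y).trans ?_
      change modelDeriv I I (fun a : G => a * x.1⁻¹) x.1 v +
        modelDeriv I I (fun a : G => x.1 * a) x.1⁻¹ w = (0 : E)
      have k := modelDeriv_comp (contMDiff_act (J := I) (N := G) I x.1)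
        (contMDiff_act (J := I) (N := G) I x.1⁻¹) 1
        (modelDeriv I I (fun a : G => a * x.1⁻¹) x.1 v)
      simp only [smul_eq_mul, mul_inv_cancel_left, mul_one, modelDeriv_id] at k
      rw [map_neg, k, add_neg_cancel]
    · refine (genAct_covec (N := G) x y u).trans ?_
      change (genTgt I x).toCLM (modelDeriv I I (fun a : G => x.1 * a) x.1⁻¹
        (modelDeriv I I (fun a : G => x.1⁻¹ * a) (x.1 * x.1⁻¹) u)) = (genTgt I x).toCLM u
      have k := modelDeriv_comp (contMDiff_act (J := I) (N := G) I x.1)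
        (contMDiff_act (J := I) (N := G) I x.1⁻¹) 1 u
      simp only [smul_eq_mul, mul_inv_cancel_left, mul_one, modelDeriv_id] at k
      simp only [mul_inv_cancel]
      rw [k]
  refine ⟨y, ?_, ?_, hxy⟩
  · refine ContinuousLinearMap.ext (M₁ := E) (M₂ := ℝ) fun ξ => ?_
    change (x.2.2 : E →L[ℝ] ℝ) (modelDeriv I I (fun a : G => a * x.1) 1
      (modelDeriv I I (fun a : G => x.1 * a) x.1⁻¹
        (modelDeriv I I (fun a : G => a * x.1⁻¹) 1 ξ))) =
      (x.2.2 : E →L[ℝ] ℝ) (modelDeriv I I (fun a : G => x.1 * a) 1 ξ)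
    have k1 := modelDeriv_comp (contMDiff_act (J := I) (N := G) I x.1)
      (contMDiff_orbit (I := I) (J := I) (G := G) x.1⁻¹) 1 ξ
    have k2 := modelDeriv_comp (contMDiff_orbit (I := I) (J := I) (G := G) x.1)
      ((contMDiff_act (J := I) (N := G) I x.1).comp
        (contMDiff_orbit (I := I) (J := I) (G := G) x.1⁻¹)) 1 ξ
    simp only [Function.comp_apply, smul_eq_mul, one_mul, mul_inv_cancel, mul_assoc,
      inv_mul_cancel, mul_one] at k1 k2
    rw [k1]
    exact congrArg (x.2.2 : E →L[ℝ] ℝ) k2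
  · rw [← genSrc_genMul x y, hxy, genSrc_genUnit]

variable (I G) in
/-- The groupoid `𝕋G ⇉ 𝔤*`, the product of the group `TG` and the groupoid `T*G ⇉ 𝔤*`. -/
def genGroupoid [LieGroup I ∞ G] : GroupoidOver (GenTangent I G) (LieDual I G) where
  src := genSrc I
  tgt := genTgt I
  unit := genUnit I
  mul := genMul I
  src_unit := genSrc_genUnit
  tgt_unit := genTgt_genUnit
  src_mul x y _ := genSrc_genMul x y
  tgt_mul x y h := genMoment_genAct (N := G) x y h
  assoc x y z _ _ := genAct_assoc (N := G) x y z
  unit_mul x := genUnit_act (I := I) (N := G) x (genTgt I x)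
  mul_unit := genMul_unit
  exists_inv x := by
    obtain ⟨y, h1, h2, h3⟩ := genMul_exists_right_inv x
    obtain ⟨z, h4, -, h6⟩ := genMul_exists_right_inv y
    refine ⟨y, h2, h1, h3, ?_⟩
    have hz : z = x := by
      have e1 : genMul I (genMul I x y) z = z := by
        rw [h3, ← h2, ← h4]; exact genUnit_act (I := I) (N := G) z (genTgt I z)
      have e2 : genMul I (genMul I x y) z = x := by
        rw [show genMul I (genMul I x y) z = genMul I x (genMul I y z) from
          genAct_assoc (N := G) x y z, h6, h1]
        exact genMul_unit x
      exact e1.symm.trans e2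
    rw [← h1, ← h6, hz]

variable (I J G N) in
/-- The action of `𝕋G ⇉ 𝔤*` on `𝕋M → 𝔤*` given by a smooth action of `G` on `M`. -/
def genAction [LieGroup I ∞ G] [ContMDiffSMul I J ∞ G N] :
    (genGroupoid I G).Action (GenTangent J N) where
  moment := genMoment I J G
  act := genAct I J
  moment_act := genMoment_genAct
  mul_act x y z _ _ := genAct_assoc x y z
  unit_act y := genUnit_act y _

end Aux

/-! ### Poisson maps as a pointwise condition, and its reading in terms of graphs. -/

section PoissonMaps

variable {E : Type*} [NormedAddCommGroup E] [NormedSpace ℝ E] {H : Type*} [TopologicalSpace H]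
  {I : ModelWithCorners ℝ E H}
  {E' : Type*} [NormedAddCommGroup E'] [NormedSpace ℝ E'] {H' : Type*} [TopologicalSpace H']
  {J : ModelWithCorners ℝ E' H'}
  {M : Type*} [TopologicalSpace M] [ChartedSpace H M]
  {N : Type*} [TopologicalSpace N] [ChartedSpace H' N]

/-! Both statements rest on one pointwise fact. A bracket at a point depends only on differentials
there, and every covector is the differential of a global smooth function. Hence a smooth `F : N →
M` is Poisson exactly when `π_M♯ μ = F_* (π_N♯ (F^* μ))` for every covector `μ` at every `F n`
(`isPoissonMap_iff`).

For the action map `𝒜`, take a covector `ν'` at `g • m` and write `𝒜^* ν' = (μ, ν)`. By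
`genAct_eq_iff`, the pairs `(μ, ν)` of this form are precisely the covector parts of composable
elements, and `ν'` is the covector part of their product. The pointwise condition therefore says
that the product of `π_G♯ μ + μ` and `π_M♯ ν + ν` lies again in `Gr(π_M)`. This is
`isPoissonMap_smul_iff`, which is the Proposition. With `M = G` acting on itself by left
multiplication, it says that `G` is a Poisson Lie group if and only if `Gr(π)` is closed under the
product of `𝕋G`.

It remains to compare closure under products with being a Lie subgroupoid. One direction is
`GroupoidOver.IsLieSubgroupoid.mul_mem`. For the other, an element of `Gr(π)` is determined by its
base point and its source, so left trivialization identifies `Gr(π)` with `G × 𝔤*`. Under this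
identification source and target become those of the coadjoint action groupoid, which is Lie. Units
and products then match by uniqueness: two elements of the graph with equal base point and equal
source coincide. For units one also needs `π` to vanish at `e` (`IsPoissonLieGroup.apply_one`). The
parametrization is an embedding because base point and source give a smooth left inverse. -/

/-- Every covector is the differential of a globally defined smooth function. -/
lemma exists_contMDiff_dFun_eq [FiniteDimensional ℝ E] [T2Space M] [IsManifold I ∞ M] (m : M)
    (μ : E →L[ℝ] ℝ) :
    ∃ f : M → ℝ, ContMDiff I 𝓘(ℝ, ℝ) ∞ f ∧ dFun I f m = μ := by
  have : IsManifold I 1 M := IsManifold.of_le (n := ∞) (by simp)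
  obtain ⟨b⟩ : Nonempty (SmoothBumpFunction I m) := inferInstance
  have hinv := isInvertible_mfderiv_extChartAt (I := I) (mem_extChartAt_source (I := I) m)
  set D : E →L[ℝ] E := mfderiv I 𝓘(ℝ, E) (extChartAt I m) m with hD
  have hinv' : D.IsInvertible := hinv
  -- `D` is the invertible differential of the chart at `m`, so `L` composed with the chart has
  -- differential `μ` at `m`. The bump function makes it global without changing its germ at `m`.
  let L : E →L[ℝ] ℝ := μ ∘L D.inverse
  refine ⟨fun x => b x • L (extChartAt I m x), b.contMDiff_smul ?_, ?_⟩
  · exact L.contMDiff.comp_contMDiffOn contMDiffOn_extChartAt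
  · have heq : (fun x => b x • L (extChartAt I m x)) =ᶠ[nhds m] (L ∘ extChartAt I m) := by
      filter_upwards [b.eventuallyEq_one] with x hx
      simp [hx]
    have h1 : mfderiv I 𝓘(ℝ, ℝ) (L ∘ extChartAt I m) m = L ∘L D := by
      rw [mfderiv_comp m L.mdifferentiableAt
        (mdifferentiableAt_extChartAt (mem_chart_source H m)), L.mfderiv_eq]
      rfl
    refine (heq.mfderiv_eq.trans h1).trans ?_
    ext v
    exact congrArg μ (hinv'.inverse_apply_eq.2 rfl)

lemma dFun_comp {f : M → ℝ} (hf : ContMDiff I 𝓘(ℝ, ℝ) ∞ f) {F : N → M} (hF : ContMDiff J I ∞ F)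
    (n : N) : dFun J (f ∘ F) n = modelDeriv I 𝓘(ℝ, ℝ) f (F n) ∘L modelDeriv J I F n :=
  mfderiv_comp n (hf.mdifferentiableAt (by simp)) (hF.mdifferentiableAt (by simp))

/-- A smooth map is Poisson if and only if it relates the bivector fields pointwise. -/
lemma isPoissonMap_iff [FiniteDimensional ℝ E] [T2Space M] [IsManifold I ∞ M]
    {PN : TensorField2 J N} {PM : TensorField2 I M} {F : N → M} (hF : ContMDiff J I ∞ F) :
    IsPoissonMap PN PM F ↔ ∀ (n : N) (μ : E →L[ℝ] ℝ),
      PM (F n) μ = modelDeriv J I F n (PN n (μ ∘L modelDeriv J I F n)) := by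
  constructor
  · intro h n μ
    -- Two vectors agree if all covectors agree on them. With `μ` and `lam` both realized as
    -- differentials, this is the bracket identity at `n`.
    refine (SeparatingDual.eq_iff_forall_dual_eq (R := ℝ) (V := E)).2 fun lam => ?_
    obtain ⟨f, hf, rfl⟩ := exists_contMDiff_dFun_eq (I := I) (F n) μ
    obtain ⟨g, hg, rfl⟩ := exists_contMDiff_dFun_eq (I := I) (F n) lam
    have key := congrFun (h.bracket_comp f g hf hg) n
    simp only [TensorField2.bracket, Function.comp_apply, dFun_comp hf hF, dFun_comp hg hF] at key
    exact key.symm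
  · refine fun h => ⟨hF, fun f g hf hg => funext fun n => ?_⟩
    simp only [TensorField2.bracket, Function.comp_apply, dFun_comp hf hF, dFun_comp hg hF]
    exact congrArg (modelDeriv I 𝓘(ℝ, ℝ) g (F n)) (h n (modelDeriv I 𝓘(ℝ, ℝ) f (F n))).symm

variable {G : Type*} [TopologicalSpace G] [ChartedSpace H G] [Group G] [MulAction G N]

/-- The action map is Poisson if and only if the action of `𝕋G` on `𝕋N` restricts to the graphs
of the Poisson structures. -/
lemma isPoissonMap_smul_iff [FiniteDimensional ℝ E'] [T2Space N] [IsManifold J ∞ N]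
    [LieGroup I ∞ G] [ContMDiffSMul I J ∞ G N] (P : TensorField2 I G) (PN : TensorField2 J N) :
    IsPoissonMap (P.prod PN) PN (fun p : G × N => p.1 • p.2) ↔
      (genAction I J N G).RestrictsTo P.graph PN.graph := by
  rw [isPoissonMap_iff contMDiff_smul]
  constructor
  · intro h x hx y hy hxy
    have hx' : x.2.1 = P x.1 x.2.2 := hx
    have hy' : y.2.1 = PN y.1 y.2.2 := hy
    obtain ⟨h1, h2⟩ := (genAct_eq_iff x y _ _).1 ⟨hxy, rfl⟩
    refine h1.trans (Eq.trans ?_ (h (x.1, y.1) (genAct I J x y).2.2).symm)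
    rw [hx', hy']
    refine congrArg (modelDeriv (I.prod J) J (fun p : G × N => p.1 • p.2) (x.1, y.1)) ?_
    refine Prod.ext (congrArg (P x.1 : (E →L[ℝ] ℝ) →L[ℝ] E) ?_)
      (congrArg (PN y.1 : (E' →L[ℝ] ℝ) →L[ℝ] E') ?_)
    -- Setting one argument to zero in `𝒜^* ν' = (μ, ν)` recovers the restriction of the pullback to
    -- the other factor, on which the product tensor acts separately.
    · refine ContinuousLinearMap.ext fun a => ((h2 a 0).trans ?_).symm
      exact (congrArg (_ + ·) (map_zero (y.2.2 : E' →L[ℝ] ℝ))).trans (add_zero _)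
    · refine ContinuousLinearMap.ext fun b => ((h2 0 b).trans ?_).symm
      exact (congrArg (· + _) (map_zero (x.2.2 : E →L[ℝ] ℝ))).trans (zero_add _)
  · rintro h ⟨g, m⟩ ν
    let D : E × E' →L[ℝ] E' := modelDeriv (I.prod J) J (fun p : G × N => p.1 • p.2) (g, m)
    let μ₁ : E →L[ℝ] ℝ := ν ∘L D ∘L ContinuousLinearMap.inl ℝ E E'
    let μ₂ : E' →L[ℝ] ℝ := ν ∘L D ∘L ContinuousLinearMap.inr ℝ E E'
    let x : GenTangent I G := ⟨g, (P g μ₁, μ₁)⟩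
    let y : GenTangent J N := ⟨m, (PN m μ₂, μ₂)⟩
    -- The covectors of `x` and `y` are the two components of `𝒜^* ν`; this alone forces
    -- composability and identifies the product.
    obtain ⟨h1, h2⟩ := (genAct_eq_iff x y (D (P g μ₁, PN m μ₂)) ν).2 ⟨rfl, fun a b =>
      (congrArg (ν ∘L D) (Prod.fst_add_snd (M := E) (N := E') (a, b)).symm).trans
        (map_add (ν ∘L D) _ _)⟩
    have h3 : genAct I J x y ∈ PN.graph := h x rfl y rfl h1
    rw [h2] at h3
    exact h3.symm

end PoissonMaps

/-! ### Smooth families of covectors and of points of `𝕋M`. -/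

section CotangentSmoothness

variable {E : Type*} [NormedAddCommGroup E] [NormedSpace ℝ E] {H : Type*} [TopologicalSpace H]
  {I : ModelWithCorners ℝ E H}
  {E' : Type*} [NormedAddCommGroup E'] [NormedSpace ℝ E'] {H' : Type*} [TopologicalSpace H']
  {J : ModelWithCorners ℝ E' H'}
  {E'' : Type*} [NormedAddCommGroup E''] [NormedSpace ℝ E''] {H'' : Type*} [TopologicalSpace H'']
  {K : ModelWithCorners ℝ E'' H''}
  {M : Type*} [TopologicalSpace M] [ChartedSpace H M] [IsManifold I ∞ M]
  {N : Type*} [TopologicalSpace N] [ChartedSpace H' N] [IsManifold J ∞ N]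
  {Q : Type*} [TopologicalSpace Q] [ChartedSpace H'' Q]

variable (I) in
/-- The point of the cotangent bundle given by a covector `κ` at `m`. -/
def cotMk (m : M) (κ : E →L[ℝ] ℝ) : TotalSpace (E →L[ℝ] ℝ) fun m : M => CotSpace I m := ⟨m, κ⟩

/-- The target bundle is trivial with fibre `ℝ`, so only the trivialization of the tangent bundle
contributes. -/
lemma inCoordinates_covector (m₀ m : M) (n₀ n : N) (κ : E →L[ℝ] ℝ) :
    ContinuousLinearMap.inCoordinates E (TangentSpace I) ℝ (fun _ : N => ℝ) m₀ m n₀ n κ =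
      κ ∘L ((trivializationAt E (TangentSpace I) m₀).symmL ℝ m : E →L[ℝ] E) := by
  ext v
  exact DFunLike.congr_fun
    (Trivial.continuousLinearMapAt_trivialization ℝ N ℝ n) _

/-- A smooth family of covectors, pulled back along a smooth family of maps, is smooth. -/
lemma ContMDiff.cotMk_comp_modelDeriv [IsManifold K ∞ Q] {F : Q → M → N}
    (hF : ContMDiff (K.prod I) J ∞ (Function.uncurry F)) {b : Q → M} (hb : ContMDiff K I ∞ b)
    {c : Q → N} (hc : ∀ q, F q (b q) = c q) {κ : Q → E' →L[ℝ] ℝ}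
    (hκ : ContMDiff K (J.prod 𝓘(ℝ, E' →L[ℝ] ℝ)) ∞ fun q => cotMk J (c q) (κ q)) :
    ContMDiff K (I.prod 𝓘(ℝ, E →L[ℝ] ℝ)) ∞
      fun q => cotMk I (b q) (κ q ∘L modelDeriv I J (F q) (b q)) := by
  have : IsManifold I 1 M := IsManifold.of_le (n := ∞) (by simp)
  have : IsManifold J 1 N := IsManifold.of_le (n := ∞) (by simp)
  have : IsManifold K 1 Q := IsManifold.of_le (n := ∞) (by simp)
  -- `c` is a separate argument so that a simplified base point, such as `1` for `g⁻¹ * g`, can be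
  -- supplied.
  obtain rfl : (fun q => F q (b q)) = c := funext hc
  intro q₀
  have hκ' := (contMDiffAt_hom_bundle _).1 (hκ q₀)
  have hD := ContMDiffAt.mfderiv (m := ∞) F b hF.contMDiffAt (hb q₀) le_rfl
  refine (contMDiffAt_hom_bundle _).2 ⟨hb q₀, ?_⟩
  refine (hκ'.2.clm_comp hD).congr_of_eventuallyEq ?_
  -- Only over this base set do the trivialization and its inverse on `TN` cancel, which makes the
  -- coordinates of the composite the composite of the coordinates.
  have hmem : ∀ᶠ q in nhds q₀, F q (b q) ∈
      (trivializationAt E' (TangentSpace J) (F q₀ (b q₀))).baseSet :=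
    hκ'.1.continuousAt ((trivializationAt E' (TangentSpace J) (F q₀ (b q₀))).open_baseSet.mem_nhds
      (FiberBundle.mem_baseSet_trivializationAt' _))
  filter_upwards [hmem] with q hq
  ext v
  have h1 := inCoordinates_covector (I := I) (b q₀) (b q) (b q₀) (b q)
    (κ q ∘L modelDeriv I J (F q) (b q))
  have h2 := inCoordinates_covector (I := J) (F q₀ (b q₀)) (F q (b q)) (F q₀ (b q₀)) (F q (b q))
    (κ q)
  refine (DFunLike.congr_fun h1 v).trans (Eq.trans ?_ (DFunLike.congr_fun h2 _).symm)
  exact congrArg (κ q) (Trivialization.symmL_continuousLinearMapAt _ hq _).symm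

/-- The tangent trivialization centred at `m` is the identity on the fibre over `m`. This passes
between smoothness in `T*M` over a fixed point and smoothness in a vector space, as needed for maps
into and out of `𝔤*`. -/
lemma contMDiff_cotMk_const_iff {m : M} {κ : Q → E →L[ℝ] ℝ} :
    ContMDiff K (I.prod 𝓘(ℝ, E →L[ℝ] ℝ)) ∞ (fun q => cotMk I m (κ q)) ↔
      ContMDiff K 𝓘(ℝ, E →L[ℝ] ℝ) ∞ κ := by
  have : IsManifold I 1 M := IsManifold.of_le (n := ∞) (by simp)
  have key : ∀ q, ContinuousLinearMap.inCoordinates E (TangentSpace I) ℝ (fun _ : M => ℝ) m m m m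
      (κ q) = κ q := fun q => by
    ext v
    have h1 : ((trivializationAt E (TangentSpace I) m).symmL ℝ m : E →L[ℝ] E) v = v := by
      rw [TangentBundle.symmL_trivializationAt_eq_core (mem_chart_source H m)]
      exact (tangentBundleCore I M).coordChange_self _ _ (mem_chart_source H m) v
    exact (DFunLike.congr_fun (inCoordinates_covector (I := I) m m m m (κ q)) v).trans
      (congrArg (κ q) h1)
  refine forall_congr' fun q₀ => (contMDiffAt_hom_bundle _).trans ?_
  refine (and_iff_right contMDiffAt_const).trans ?_
  exact iff_of_eq (congrArg (fun f => ContMDiffAt K 𝓘(ℝ, E →L[ℝ] ℝ) ∞ f q₀) (funext key))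

/-- In product trivializations the projection `𝕋M → T*M` is the second projection of the model
fibre. -/
lemma contMDiff_cotMk_genTangent :
    ContMDiff (I.prod 𝓘(ℝ, E × (E →L[ℝ] ℝ))) (I.prod 𝓘(ℝ, E →L[ℝ] ℝ)) ∞
      (fun x : GenTangent I M => cotMk I x.1 x.2.2) := by
  intro x
  have h := contMDiffAt_totalSpace.1 (contMDiffAt_id (x := x)
    (I := I.prod 𝓘(ℝ, E × (E →L[ℝ] ℝ))) (n := ∞))
  refine contMDiffAt_totalSpace.2 ⟨h.1, ?_⟩
  exact (ContinuousLinearMap.snd ℝ E (E →L[ℝ] ℝ)).contMDiff.contMDiffAt.comp x h.2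

lemma ContMDiff.genTangent_mk {m : Q → M} {v : Q → E} {κ : Q → E →L[ℝ] ℝ}
    (hv : ContMDiff K (I.prod 𝓘(ℝ, E)) ∞ fun q => (⟨m q, v q⟩ : TangentBundle I M))
    (hκ : ContMDiff K (I.prod 𝓘(ℝ, E →L[ℝ] ℝ)) ∞ fun q => cotMk I (m q) (κ q)) :
    ContMDiff K (I.prod 𝓘(ℝ, E × (E →L[ℝ] ℝ))) ∞
      fun q => (⟨m q, (v q, κ q)⟩ : GenTangent I M) := by
  intro q
  have h1 := contMDiffAt_totalSpace.1 (hv q)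
  have h2 := contMDiffAt_totalSpace.1 (hκ q)
  refine contMDiffAt_totalSpace.2 ⟨h1.1, ?_⟩
  exact h1.2.prodMk_space h2.2

lemma TensorField2.IsPoisson.contMDiff_graph_mk {P : TensorField2 I M} (hP : P.IsPoisson)
    {m : Q → M} {κ : Q → E →L[ℝ] ℝ}
    (hκ : ContMDiff K (I.prod 𝓘(ℝ, E →L[ℝ] ℝ)) ∞ fun q => cotMk I (m q) (κ q)) :
    ContMDiff K (I.prod 𝓘(ℝ, E × (E →L[ℝ] ℝ))) ∞
      fun q => (⟨m q, (P (m q) (κ q), κ q)⟩ : GenTangent I M) := by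
  have hm : ContMDiff K I ∞ m := (contMDiff_proj _).comp hκ
  exact ContMDiff.genTangent_mk (ContMDiff.clm_bundle_apply (hP.smooth.comp hm) hκ) hκ

end CotangentSmoothness

/-! ### Embeddings and submersions from one-sided inverses. -/

section SmoothEmbedding

variable {E : Type*} [NormedAddCommGroup E] [NormedSpace ℝ E] {H : Type*} [TopologicalSpace H]
  {I : ModelWithCorners ℝ E H}
  {E' : Type*} [NormedAddCommGroup E'] [NormedSpace ℝ E'] {H' : Type*} [TopologicalSpace H']
  {J : ModelWithCorners ℝ E' H'}
  {M : Type*} [TopologicalSpace M] [ChartedSpace H M]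
  {N : Type*} [TopologicalSpace N] [ChartedSpace H' N]

lemma modelDeriv_leftInverse {f : M → N} {r : N → M} (hf : ContMDiff I J ∞ f)
    (hr : ContMDiff J I ∞ r) (h : Function.LeftInverse r f) (x : M) (v : E) :
    modelDeriv J I r (f x) (modelDeriv I J f x v) = v := by
  rw [modelDeriv_comp hr hf, show (fun y => r (f y)) = fun y => y from funext h, modelDeriv_id]

/-- A smooth map with a smooth left inverse is a smooth embedding. -/
lemma IsSmoothEmb.of_leftInverse {f : M → N} {r : N → M} (hf : ContMDiff I J ∞ f)
    (hr : ContMDiff J I ∞ r) (h : Function.LeftInverse r f) : IsSmoothEmb I J f where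
  contMDiff := hf
  injective_mfderiv x := fun v w hvw => by
    have hvw' : modelDeriv I J f x v = modelDeriv I J f x w := hvw
    exact (modelDeriv_leftInverse hf hr h x v).symm.trans
      ((congrArg (modelDeriv J I r (f x)) hvw').trans (modelDeriv_leftInverse hf hr h x w))
  isEmbedding := h.isEmbedding hr.continuous hf.continuous

/-- A smooth map with a smooth section through every point is a submersion. -/
lemma IsSmoothSubmersion.of_sections {f : M → N} (hf : ContMDiff I J ∞ f)
    (h : ∀ x, ∃ s : N → M, ContMDiff J I ∞ s ∧ Function.LeftInverse f s ∧ s (f x) = x) :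
    IsSmoothSubmersion I J f where
  contMDiff := hf
  surjective_mfderiv x := by
    obtain ⟨s, hs, hfs, hx⟩ := h x
    intro w
    refine ⟨modelDeriv J I s (f x) w, ?_⟩
    have := modelDeriv_leftInverse hs hf hfs (f x) w
    -- The section passes through `x`, so the differential of `f` at `s (f x)` is the one at `x`.
    rwa [hx] at this

end SmoothEmbedding

/-! ### The graph as a copy of the coadjoint action groupoid. -/

section GraphGroupoid

variable {E : Type*} [NormedAddCommGroup E] [NormedSpace ℝ E]
  {H : Type*} [TopologicalSpace H] {I : ModelWithCorners ℝ E H}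
  {G : Type*} [TopologicalSpace G] [ChartedSpace H G] [Group G]

/-- The coadjoint action of `g` on `𝔤*`. -/
def coadjoint (g : G) (ν : LieDual I G) : LieDual I G :=
  ν.toCLM ∘L modelDeriv I I (fun a : G => g⁻¹ * (a * g)) 1

lemma coadjoint_one (ν : LieDual I G) : coadjoint 1 ν = ν := by
  refine ContinuousLinearMap.ext (M₁ := E) (M₂ := ℝ) fun v => ?_
  change ν.toCLM (modelDeriv I I (fun a : G => (1 : G)⁻¹ * (a * 1)) 1 v) = ν.toCLM v
  simp only [inv_one, one_mul, mul_one, modelDeriv_id]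

lemma contMDiff_toCLM_snd : ContMDiff (I.prod 𝓘(ℝ, LieDual I G)) 𝓘(ℝ, E →L[ℝ] ℝ) ∞
    fun p : G × LieDual I G => p.2.toCLM :=
  (contMDiff_snd : ContMDiff (I.prod 𝓘(ℝ, LieDual I G)) 𝓘(ℝ, LieDual I G) ∞
    (Prod.snd : G × LieDual I G → LieDual I G))

/-- The point of `T*G` with base point `g` and left trivialization `ν`. -/
def ofLeftTriv (g : G) (ν : LieDual I G) : E →L[ℝ] ℝ :=
  ν.toCLM ∘L modelDeriv I I (fun a : G => g⁻¹ * a) g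

/-- The parametrization of the graph of `P` by `G × 𝔤*`. -/
def graphMk (P : TensorField2 I G) (p : G × LieDual I G) : GenTangent I G :=
  ⟨p.1, (P p.1 (ofLeftTriv (E := E) p.1 p.2), ofLeftTriv (E := E) p.1 p.2)⟩

lemma graphMk_mem (P : TensorField2 I G) (p : G × LieDual I G) : graphMk P p ∈ P.graph := rfl

variable [LieGroup I ∞ G]

lemma contMDiff_conj_inv (g : G) : ContMDiff I I ∞ (fun a : G => g⁻¹ * (a * g)) :=
  (contMDiff_mul_left (I := I) (a := g⁻¹)).comp (contMDiff_mul_right (I := I) (a := g))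

lemma coadjoint_mul (g h : G) (ν : LieDual I G) :
    coadjoint (g * h) ν = coadjoint g (coadjoint h ν) := by
  refine ContinuousLinearMap.ext (M₁ := E) (M₂ := ℝ) fun v => ?_
  have k := modelDeriv_comp (contMDiff_conj_inv (I := I) h) (contMDiff_conj_inv (I := I) g) 1 v
  simp only [one_mul, inv_mul_cancel] at k
  change ν.toCLM (modelDeriv I I (fun a : G => (g * h)⁻¹ * (a * (g * h))) 1 v) =
    ν.toCLM (modelDeriv I I (fun a : G => h⁻¹ * (a * h)) 1
      (modelDeriv I I (fun a : G => g⁻¹ * (a * g)) 1 v))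
  rw [k]
  simp only [mul_inv_rev, mul_assoc]

variable (I G) in
/-- The action groupoid `G × 𝔤* ⇉ 𝔤*` of the coadjoint action, that is, the cotangent groupoid
`T*G ⇉ 𝔤*` in the left trivialization. -/
def coadjointGroupoid : GroupoidOver (G × LieDual I G) (LieDual I G) where
  src p := p.2
  tgt p := coadjoint p.1 p.2
  unit ν := (1, ν)
  mul p q := (p.1 * q.1, q.2)
  src_unit _ := rfl
  tgt_unit := coadjoint_one
  src_mul _ _ _ := rfl
  tgt_mul p q h := (coadjoint_mul _ _ _).trans (congrArg (coadjoint p.1) h.symm)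
  assoc _ _ _ _ _ := Prod.ext (mul_assoc _ _ _) rfl
  unit_mul _ := Prod.ext (one_mul _) rfl
  mul_unit _ := Prod.ext (mul_one _) rfl
  exists_inv p := by
    have h : coadjoint p.1⁻¹ (coadjoint p.1 p.2) = p.2 := by
      rw [← coadjoint_mul, inv_mul_cancel, coadjoint_one]
    exact ⟨(p.1⁻¹, coadjoint p.1 p.2), rfl, h, Prod.ext (mul_inv_cancel _) rfl,
      Prod.ext (inv_mul_cancel _) rfl⟩

/-- The source is the pullback of `μ` at `1` along the smooth family of left translations by the
base point. -/
lemma contMDiff_genSrc : ContMDiff (I.prod 𝓘(ℝ, E × (E →L[ℝ] ℝ))) 𝓘(ℝ, LieDual I G) ∞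
    (genSrc I : GenTangent I G → LieDual I G) := by
  refine contMDiff_cotMk_const_iff (I := I) (m := (1 : G)) (κ := genSrc I).1 ?_
  exact ContMDiff.cotMk_comp_modelDeriv (F := fun (x : GenTangent I G) (a : G) => x.1 * a)
    (((contMDiff_proj _).comp contMDiff_fst).mul contMDiff_snd) contMDiff_const
    (c := fun x => x.1) (fun x => mul_one x.1) contMDiff_cotMk_genTangent

lemma contMDiff_cotMk_ofLeftTriv :
    ContMDiff (I.prod 𝓘(ℝ, LieDual I G)) (I.prod 𝓘(ℝ, E →L[ℝ] ℝ)) ∞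
      fun p : G × LieDual I G => cotMk I p.1 (ofLeftTriv p.1 p.2) := by
  refine ContMDiff.cotMk_comp_modelDeriv (K := I.prod 𝓘(ℝ, LieDual I G))
    (F := fun (p : G × LieDual I G) (a : G) => p.1⁻¹ * a)
    ((contMDiff_fst.comp contMDiff_fst).inv.mul contMDiff_snd) contMDiff_fst
    (c := fun _ => 1) (fun p => inv_mul_cancel p.1) (κ := fun p => p.2.toCLM) ?_
  exact contMDiff_cotMk_const_iff.2 contMDiff_toCLM_snd

lemma contMDiff_coadjoint :
    ContMDiff (I.prod 𝓘(ℝ, LieDual I G)) 𝓘(ℝ, LieDual I G) ∞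
      fun p : G × LieDual I G => coadjoint p.1 p.2 := by
  refine contMDiff_cotMk_const_iff (I := I) (m := (1 : G)).1 ?_
  refine ContMDiff.cotMk_comp_modelDeriv (K := I.prod 𝓘(ℝ, LieDual I G))
    (F := fun (p : G × LieDual I G) (a : G) => p.1⁻¹ * (a * p.1))
    ((contMDiff_fst.comp contMDiff_fst).inv.mul
      (contMDiff_snd.mul (contMDiff_fst.comp contMDiff_fst))) contMDiff_const
    (c := fun _ => 1) (fun p => by simp) (κ := fun p => p.2.toCLM) ?_
  exact contMDiff_cotMk_const_iff.2 contMDiff_toCLM_snd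

/-- Through `(g, ν)` pass the constant-`g` sections: `ν' ↦ (g, ν')` of the source and `ν' ↦ (g, g⁻¹
· ν')` of the target. The product formula is smooth on all pairs, composable or not. -/
lemma coadjointGroupoid_isLie :
    (coadjointGroupoid I G).IsLie (I.prod 𝓘(ℝ, LieDual I G)) 𝓘(ℝ, LieDual I G) where
  src := .of_sections contMDiff_snd fun p =>
    ⟨fun ν => (p.1, ν), contMDiff_const.prodMk contMDiff_id, fun _ => rfl, rfl⟩
  tgt := .of_sections contMDiff_coadjoint fun p =>
    ⟨fun ν => (p.1, coadjoint p.1⁻¹ ν), contMDiff_const.prodMk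
      (contMDiff_coadjoint.comp (contMDiff_const.prodMk contMDiff_id)),
      fun ν => show coadjoint p.1 (coadjoint p.1⁻¹ ν) = ν by
        rw [← coadjoint_mul, mul_inv_cancel, coadjoint_one],
      Prod.ext rfl (show coadjoint p.1⁻¹ (coadjoint p.1 p.2) = p.2 by
        rw [← coadjoint_mul, inv_mul_cancel, coadjoint_one])⟩
  unit := .of_leftInverse (contMDiff_const.prodMk contMDiff_id) contMDiff_snd fun _ => rfl
  mul := (((contMDiff_fst.comp contMDiff_fst).mul (contMDiff_fst.comp contMDiff_snd)).prodMk
    (contMDiff_snd.comp contMDiff_snd)).contMDiffOn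

lemma genSrc_graphMk (P : TensorField2 I G) (p : G × LieDual I G) :
    genSrc I (graphMk P p) = p.2 := by
  refine ContinuousLinearMap.ext (M₁ := E) (M₂ := ℝ) fun v => ?_
  have k := modelDeriv_comp (contMDiff_mul_left (I := I) (a := p.1⁻¹))
    (contMDiff_mul_left (I := I) (a := p.1)) 1 v
  simp only [mul_one, inv_mul_cancel_left, modelDeriv_id] at k
  exact congrArg p.2.toCLM k

/-- Left translation by `g⁻¹` after right translation by `g` is the conjugation that defines the
coadjoint action. -/
lemma genTgt_graphMk (P : TensorField2 I G) (p : G × LieDual I G) :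
    genTgt I (graphMk P p) = coadjoint p.1 p.2 := by
  refine ContinuousLinearMap.ext (M₁ := E) (M₂ := ℝ) fun v => ?_
  have k := modelDeriv_comp (contMDiff_mul_left (I := I) (a := p.1⁻¹))
    (contMDiff_mul_right (I := I) (a := p.1)) 1 v
  simp only [one_mul] at k
  exact congrArg p.2.toCLM k

/-- Left translation is invertible, so base point and source recover the covector, and membership in
the graph then forces the vector. All later identifications inside the graph use this uniqueness. -/
lemma graphMk_genSrc {P : TensorField2 I G} {x : GenTangent I G} (hx : x ∈ P.graph) :
    graphMk P (x.1, genSrc I x) = x := by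
  have hκ : ofLeftTriv x.1 (genSrc I x) = x.2.2 := by
    refine ContinuousLinearMap.ext (M₁ := E) (M₂ := ℝ) fun v => ?_
    have k := modelDeriv_comp (contMDiff_mul_left (I := I) (a := x.1))
      (contMDiff_mul_left (I := I) (a := x.1⁻¹)) x.1 v
    simp only [inv_mul_cancel, mul_inv_cancel_left, modelDeriv_id] at k
    exact congrArg (x.2.2 : E →L[ℝ] ℝ) k
  have hx' : P x.1 x.2.2 = x.2.1 := Eq.symm hx
  refine genTangent_ext rfl ?_ fun v => DFunLike.congr_fun hκ v
  exact (congrArg (P x.1 : (E →L[ℝ] ℝ) →L[ℝ] E) hκ).trans hx'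

variable [FiniteDimensional ℝ E]

/-- If `P` is multiplicative, then it vanishes at the unit. -/
lemma IsPoissonLieGroup.apply_one [T2Space G] {P : TensorField2 I G} (h : IsPoissonLieGroup P)
    (μ : E →L[ℝ] ℝ) : (P 1 μ : E) = 0 := by
  have hclosed := (isPoissonMap_smul_iff (N := G) P P).1 h.isPoissonMap_mul
  let x : GenTangent I G := ⟨1, (P 1 μ, μ)⟩
  have hsrc : genSrc I x = μ := by
    refine ContinuousLinearMap.ext (M₁ := E) (M₂ := ℝ) fun v => ?_
    change μ (modelDeriv I I (fun a : G => 1 * a) 1 v) = μ v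
    simp only [one_mul, modelDeriv_id]
  have htgt : genTgt I x = μ := by
    refine ContinuousLinearMap.ext (M₁ := E) (M₂ := ℝ) fun v => ?_
    change μ (modelDeriv I I (fun a : G => a * 1) 1 v) = μ v
    simp only [mul_one, modelDeriv_id]
  -- Over `e` source and target agree, so `x` composes with itself; `x ∘ x` has the base point and
  -- source of `x`, hence equals `x`.
  have hmem : genMul I x x ∈ P.graph := hclosed x rfl x rfl (hsrc.trans htgt.symm)
  have h1 := graphMk_genSrc hmem
  rw [genSrc_genMul, show (genMul I x x).1 = x.1 from mul_one 1,
    graphMk_genSrc (x := x) (P := P) rfl] at h1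
  have h2 : (P 1 μ : E) = (genMul I x x).2.1 := congrArg (fun y : GenTangent I G => (y.2.1 : E)) h1
  let w : E := P 1 μ
  -- Multiplication has differential `(a, b) ↦ a + b` at `(e, e)`, so `x ∘ x = x` gives `w = w + w`.
  have h3 : w = modelDeriv I I (fun a : G => a * 1) 1 w +
      modelDeriv I I (fun a : G => 1 * a) 1 w := h2.trans (genAct_vec (N := G) x x)
  simp only [mul_one, one_mul, modelDeriv_id] at h3
  exact left_eq_add.1 h3

/-- The graph of the Poisson structure of a Poisson Lie group is a Lie subgroupoid of `𝕋G`. -/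
lemma IsPoissonLieGroup.isLieSubgroupoid_graph [I.Boundaryless] [T2Space G] {P : TensorField2 I G}
    (h : IsPoissonLieGroup P) :
    (genGroupoid I G).IsLieSubgroupoid (I.prod 𝓘(ℝ, E × (E →L[ℝ] ℝ))) 𝓘(ℝ, LieDual I G)
      P.graph := by
  have hclosed := (isPoissonMap_smul_iff (N := G) P P).1 h.isPoissonMap_mul
  have : FiniteDimensional ℝ (LieDual I G) := inferInstanceAs (FiniteDimensional ℝ (E →L[ℝ] ℝ))
  refine ⟨⟨G × LieDual I G, E × LieDual I G, ModelProd H (LieDual I G), I.prod 𝓘(ℝ, LieDual I G)⟩,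
    ⟨LieDual I G, LieDual I G, LieDual I G, 𝓘(ℝ, LieDual I G)⟩,
    coadjointGroupoid I G, graphMk P, id, coadjointGroupoid_isLie,
    .of_leftInverse (r := fun x => (x.1, genSrc I x))
      (h.isPoisson.contMDiff_graph_mk contMDiff_cotMk_ofLeftTriv)
      ((contMDiff_proj _).prodMk contMDiff_genSrc) fun p => Prod.ext rfl (genSrc_graphMk P p),
    .of_leftInverse (r := id) contMDiff_id contMDiff_id fun _ => rfl, ?_,
    genSrc_graphMk P, genTgt_graphMk P, fun ν => ?_, fun p q hpq => ?_⟩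
  · exact Set.Subset.antisymm (Set.range_subset_iff.2 (graphMk_mem P))
      fun x hx => ⟨_, graphMk_genSrc hx⟩
  -- Since `P` vanishes at `e`, the unit `0 + ν` lies in the graph.
  · have hu := graphMk_genSrc (P := P) (x := genUnit I ν) (h.apply_one ν).symm
    rwa [genSrc_genUnit] at hu
  -- The product lies in the graph by closure, with base point `p.1 * q.1` and source `q.2`, so it
  -- is the point parametrized by the product in the coadjoint groupoid.
  · have hm := graphMk_genSrc (P := P) (x := genMul I (graphMk P p) (graphMk P q))
      (hclosed _ (graphMk_mem P p) _ (graphMk_mem P q)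
        ((genSrc_graphMk P p).trans (Eq.trans hpq (genTgt_graphMk P q).symm)))
    rwa [genSrc_genMul, genSrc_graphMk] at hm

end GraphGroupoid

/-! ### Closure of Lie subgroupoids under products, and the theorem. -/

section

variable {E : Type*} [NormedAddCommGroup E] [NormedSpace ℝ E]
  {H : Type*} [TopologicalSpace H] {I : ModelWithCorners ℝ E H}
  {E' : Type*} [NormedAddCommGroup E'] [NormedSpace ℝ E'] {H' : Type*} [TopologicalSpace H']
  {J : ModelWithCorners ℝ E' H'}
  {Γ : Type*} [TopologicalSpace Γ] [ChartedSpace H Γ]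
  {B : Type*} [TopologicalSpace B] [ChartedSpace H' B]

/-- Injectivity of the inclusion of bases lifts composability from the ambient groupoid to the
subgroupoid, where the product can be formed. -/
lemma GroupoidOver.IsLieSubgroupoid.mul_mem {𝒢 : GroupoidOver Γ B} {S : Set Γ}
    (hS : 𝒢.IsLieSubgroupoid I J S) {x y : Γ} (hx : x ∈ S) (hy : y ∈ S)
    (hxy : 𝒢.src x = 𝒢.tgt y) : 𝒢.mul x y ∈ S := by
  obtain ⟨A, C, 𝓗, i, j, -, -, hj, rfl, hsrc, htgt, -, hmul⟩ := hS
  obtain ⟨a, rfl⟩ := hx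
  obtain ⟨b, rfl⟩ := hy
  rw [hsrc, htgt] at hxy
  exact ⟨𝓗.mul a b, hmul a b (hj.isEmbedding.injective hxy)⟩

end

theorem mainTheorem10
    {E : Type*} [NormedAddCommGroup E] [NormedSpace ℝ E] [FiniteDimensional ℝ E]
    {H : Type*} [TopologicalSpace H] (I : ModelWithCorners ℝ E H) [I.Boundaryless]
    (G : Type*) [TopologicalSpace G] [T2Space G] [SecondCountableTopology G] [ChartedSpace H G]
    [Group G] [LieGroup I ∞ G]
    (P : TensorField2 I G) (hP : P.IsPoisson) :
    (IsPoissonLieGroup P ↔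
      (genGroupoid I G).IsLieSubgroupoid (I.prod 𝓘(ℝ, E × (E →L[ℝ] ℝ))) 𝓘(ℝ, LieDual I G)
        P.graph) ∧
    (IsPoissonLieGroup P →
      ∀ {E' : Type*} [NormedAddCommGroup E'] [NormedSpace ℝ E'] [FiniteDimensional ℝ E']
        {H' : Type*} [TopologicalSpace H'] (J : ModelWithCorners ℝ E' H') [J.Boundaryless]
        (M : Type*) [TopologicalSpace M] [T2Space M] [SecondCountableTopology M]
        [ChartedSpace H' M] [IsManifold J ∞ M] (PM : TensorField2 J M), PM.IsPoisson →
        ∀ [MulAction G M] [ContMDiffSMul I J ∞ G M],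
          (IsPoissonMap (P.prod PM) PM (fun p : G × M => p.1 • p.2) ↔
            (genAction I J M G).RestrictsTo P.graph PM.graph)) := by
  refine ⟨⟨fun h => h.isLieSubgroupoid_graph, fun h => ⟨hP, ?_⟩⟩, ?_⟩
  · exact (isPoissonMap_smul_iff (N := G) P P).2 fun x hx y hy hxy => h.mul_mem hx hy hxy
  · intro _ E' _ _ _ H' _ J _ M _ _ _ _ _ PM _ _ _
    exact isPoissonMap_smul_iff P PM
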